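/- **Setting.** Let $u_0,v_0>0$, $K(u,v)=[0,u]\times[v,\infty)$, $\mathcal C_{in}=[0,u_0]\times\{v_0\}$ and $\mathcal C_{out}=\{0\}\times[v_0,\infty)$ (the event horizon, whose ideal endpoint $(0,\infty)$ is $i^+$). Let $\mathcal G\subset K(u_0,v_0)$ be relatively open with $\mathcal C_{in}\cup\mathcal C_{out}\subset\mathcal G$, carrying the Lorentzian metric $-\Omega^2\,du\,dv$ with $\Omega>0$ smooth and time orientation such that $u$ and $v$ increase to the future, a smooth radial function $r\ge 0$ with $r>0$ on $\mathcal C_{in}\cup\mathcal C_{out}$, and smooth functions $T_{uu},T_{uv},T_{vv}$ such that, with the Hawking mass $m=\frac r2(1+4\Omega^{-2}\partial_u r\,\partial_v r)$, the spherically symmetric Einstein equations hold on $\mathcal G$: $$\partial_u(\Omega^{-2}\partial_u r)=-r\Omega^{-2}T_{uu},\qquad \partial_v(\Omega^{-2}\partial_v r)=-r\Omega^{-2}T_{vv},$$ $$\partial_u m=2r^2\Omega^{-2}(T_{uv}\partial_u r-T_{uu}\partial_v r),\qquad \partial_v m=2r^2\Omega^{-2}(T_{uv}\partial_v r-T_{vv}\partial_u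 r).$$ Put $\mathcal R=\{p\in\mathcal G:\partial_v r>0,\ \partial_u r<0\}$ (regular region) and $\mathcal A=\{p\in\mathcal G:\partial_v r=0,\ \partial_u r<0\}$ (marginally trapped tube). Write $J^\pm(p)$ for the causal future/past and $I^-(p)$ for the chronological past of $p$ in $K(u_0,v_0)$, i.e. $J^-(p)=\{q:u(q)\le u(p),\,v(q)\le v(p)\}$, $I^-(p)=\{q:u(q)<u(p),\,v(q)<v(p)\}$. Assume: * **I** $T_{uu},T_{uv},T_{vv}\ge 0$ on $\mathcal G$; * **II** $J^-(\mathcal G)\subset\mathcal G$; * **III** $r_+:=\sup_{\mathcal C_{out}}r<\infty$; * **IV** $m\ge0$ on $\mathcal C_{out}$ and $m_+:=\sup_{\mathcal C_{out}}m<\infty$; * **V** $\partial_u r<0$ on $\mathcal C_{out}$; * **VI** $\partial_v r>0$ on $\mathcal C_{out}$; * **VII** if $p\in\overline{\mathcal R}$ and $q\in\overline{\mathcal R}\cap I^-(p)$ satisfy $(J^-(p)\cap J^+(q))\setminus\{p\}\subset\mathcal R\cup\mathcal A$, then $p\in\mathcal R\cup\mathcal A$ (closures in $K(u_0,v_0)$).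 **Theorem.** For $\delta>0$ let $\mathcal W(\delta)=\{p\in\mathcal G:r(p)\ge r_+-\delta\}$. Suppose there are constants $0<c_0<\frac1{4r_+^2}$, $c_1,c_2>0$, $0<\epsilon<\frac1{4r_+^2}-c_0$, $v'\ge v_0$ and $\delta>0$ such that, with $\mathcal W=\mathcal W(\delta)$: * **A′** $T_{uv}\Omega^{-2}\le c_0$ in $\mathcal W\cap\mathcal R$; * **B1** $T_{uu}/(\partial_u r)^2\le c_1$ in $\mathcal W\cap\mathcal R$; * **B2** for every $u\in[0,u_0]$ the function $\partial_v(\Omega^{-2}T_{uv})(u,\cdot)$ is integrable on $\{v\ge v_0:(u,v)\in\mathcal G\}$, and $\int_{v'}^v\partial_v(\Omega^{-2}T_{uv})(u,\tilde v)\,d\tilde v<\epsilon$ for all $(u,v)\in\mathcal W\cap\mathcal R$ with $v\ge v'$; * **C** $(-\partial_u r)\Omega^{-2}\le c_2$ along $\mathcal C_{out}\cap\mathcal W$. Then there is $U\in(0,u_0]$ such that the marginally trapped tube is asymptotic to the event horizon: for every $u\in(0,U]$ there is $v>v_0$ with $(u,v)\in\mathcal A$. Furthermore, near $i^+$, for large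 $v$, the tube is connected and achronal with no ingoing null segments: there is $V\ge v_0$ such that for every $V_1\ge V$ the set $\mathcal A\cap K(U,V_1)$ is nonempty and connected, contains no two points $(u_1,v_1),(u_2,v_2)$ with $u_1<u_2$ and $v_1<v_2$, and contains no segment $[a,b]\times\{v\}$ with $a<b$. -/

import Mathlib

open scoped ContDiff

noncomputable section

namespace SphericalSpacetime

/-! Points of the plane are pairs `(u, v)` of double null coordinates; `u` is the ingoing and `v`
the outgoing null coordinate, and both increase towards the future. -/

/-- The characteristic rectangle `K(u, v) = [0, u] × [v, ∞)`. -/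
def K (u v : ℝ) : Set (ℝ × ℝ) := Set.Icc 0 u ×ˢ Set.Ici v

/-- The ingoing initial hypersurface `[0, u₀] × {v₀}`. -/
def Cin (u₀ v₀ : ℝ) : Set (ℝ × ℝ) := Set.Icc 0 u₀ ×ˢ {v₀}

/-- The outgoing initial hypersurface `{0} × [v₀, ∞)`, which plays the role of the event horizon. -/
def Cout (v₀ : ℝ) : Set (ℝ × ℝ) := {0} ×ˢ Set.Ici v₀

/-- Causal past of a point for the conformally flat metric `-Ω² du dv`. -/
def causalPast (p : ℝ × ℝ) : Set (ℝ × ℝ) := {q | q.1 ≤ p.1 ∧ q.2 ≤ p.2}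

/-- Causal future of a point. -/
def causalFuture (p : ℝ × ℝ) : Set (ℝ × ℝ) := {q | p.1 ≤ q.1 ∧ p.2 ≤ q.2}

/-- Chronological past of a point. -/
def chronologicalPast (p : ℝ × ℝ) : Set (ℝ × ℝ) := {q | q.1 < p.1 ∧ q.2 < p.2}

/-- A set is achronal if no two of its points are chronologically related. -/
def Achronal (S : Set (ℝ × ℝ)) : Prop := ∀ p ∈ S, ∀ q ∈ S, q ∉ chronologicalPast p

/-- A set has no ingoing null segments if it contains no nondegenerate segment
`[a, b] × {v}` of a curve `v = const`. -/
def NoIngoingNullSegments (S : Set (ℝ × ℝ)) : Prop :=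
  ∀ a b v : ℝ, a < b → ¬ (Set.Icc a b ×ˢ {v} ⊆ S)

/-- `∂_u f` on a region `G` (one-sided where `G` has boundary points). -/
def du (G : Set (ℝ × ℝ)) (f : ℝ × ℝ → ℝ) (p : ℝ × ℝ) : ℝ := fderivWithin ℝ f G p (1, 0)

/-- `∂_v f` on a region `G` (one-sided where `G` has boundary points). -/
def dv (G : Set (ℝ × ℝ)) (f : ℝ × ℝ → ℝ) (p : ℝ × ℝ) : ℝ := fderivWithin ℝ f G p (0, 1)

/-- The Hawking mass `m = (r / 2) (1 + 4 Ω⁻² ∂_u r ∂_v r)`. -/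
def hawkingMass (G : Set (ℝ × ℝ)) (Ω r : ℝ × ℝ → ℝ) (p : ℝ × ℝ) : ℝ :=
  r p / 2 * (1 + 4 * (Ω p ^ 2)⁻¹ * du G r p * dv G r p)

/-- The quotient `(G, -Ω² du dv)` of a spherically symmetric spacetime with metric
`-Ω² du dv + r² g_{S²}`: a relatively open subset `G` of the rectangle `K(u₀, v₀)` that contains
the two initial hypersurfaces, with the radial function `r`, the components `T_uu`, `T_uv`, `T_vv`
of the stress-energy tensor and the Einstein equations `R_ab - (1/2) R g_ab = 2 T_ab` written on
the quotient. -/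
structure Spacetime (u₀ v₀ : ℝ) where
  u₀_pos : 0 < u₀
  v₀_pos : 0 < v₀
  G : Set (ℝ × ℝ)
  relOpen : ∃ O : Set (ℝ × ℝ), IsOpen O ∧ G = O ∩ K u₀ v₀
  Cin_subset : Cin u₀ v₀ ⊆ G
  Cout_subset : Cout v₀ ⊆ G
  Ω : ℝ × ℝ → ℝ
  r : ℝ × ℝ → ℝ
  Tuu : ℝ × ℝ → ℝ
  Tuv : ℝ × ℝ → ℝ
  Tvv : ℝ × ℝ → ℝ
  Ω_smooth : ContDiffOn ℝ ∞ Ω G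
  r_smooth : ContDiffOn ℝ ∞ r G
  Tuu_smooth : ContDiffOn ℝ ∞ Tuu G
  Tuv_smooth : ContDiffOn ℝ ∞ Tuv G
  Tvv_smooth : ContDiffOn ℝ ∞ Tvv G
  Ω_pos : ∀ p ∈ G, 0 < Ω p
  r_nonneg : ∀ p ∈ G, 0 ≤ r p
  r_pos : ∀ p ∈ Cin u₀ v₀ ∪ Cout v₀, 0 < r p
  /-- `∂_u (Ω⁻² ∂_u r) = -r Ω⁻² T_uu` -/
  raychaudhuri_u : ∀ p ∈ G,
    du G (fun x => (Ω x ^ 2)⁻¹ * du G r x) p = -(r p * (Ω p ^ 2)⁻¹ * Tuu p)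
  /-- `∂_v (Ω⁻² ∂_v r) = -r Ω⁻² T_vv` -/
  raychaudhuri_v : ∀ p ∈ G,
    dv G (fun x => (Ω x ^ 2)⁻¹ * dv G r x) p = -(r p * (Ω p ^ 2)⁻¹ * Tvv p)
  /-- `∂_u m = 2 r² Ω⁻² (T_uv ∂_u r - T_uu ∂_v r)` -/
  mass_u : ∀ p ∈ G, du G (hawkingMass G Ω r) p =
    2 * r p ^ 2 * (Ω p ^ 2)⁻¹ * (Tuv p * du G r p - Tuu p * dv G r p)
  /-- `∂_v m = 2 r² Ω⁻² (T_uv ∂_v r - T_vv ∂_u r)` -/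
  mass_v : ∀ p ∈ G, dv G (hawkingMass G Ω r) p =
    2 * r p ^ 2 * (Ω p ^ 2)⁻¹ * (Tuv p * dv G r p - Tvv p * du G r p)

namespace Spacetime

variable {u₀ v₀ : ℝ} (S : Spacetime u₀ v₀)

/-- `∂_u r`. -/
def ru (p : ℝ × ℝ) : ℝ := du S.G S.r p

/-- `∂_v r`. -/
def rv (p : ℝ × ℝ) : ℝ := dv S.G S.r p

/-- The Hawking mass of the spacetime. -/
def m (p : ℝ × ℝ) : ℝ := hawkingMass S.G S.Ω S.r p

/-- The function `Ω⁻² T_uv`. -/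
def scaledTuv (p : ℝ × ℝ) : ℝ := (S.Ω p ^ 2)⁻¹ * S.Tuv p

/-- The regular region. -/
def regular : Set (ℝ × ℝ) := {p | p ∈ S.G ∧ 0 < S.rv p ∧ S.ru p < 0}

/-- The marginally trapped tube. -/
def tube : Set (ℝ × ℝ) := {p | p ∈ S.G ∧ S.rv p = 0 ∧ S.ru p < 0}

/-- The region `W(δ)` in which `r ≥ r₊ - δ`. -/
def W (rPlus δ : ℝ) : Set (ℝ × ℝ) := {p | p ∈ S.G ∧ rPlus - δ ≤ S.r p}

/-- The standing assumptions on a black hole spacetime whose outgoing initial hypersurface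
is (a part of) the event horizon. The closures in the extension principle are taken in the
rectangle `K(u₀, v₀)`, which is closed in the plane. -/
structure IsBlackHole (rPlus mPlus : ℝ) : Prop where
  /-- I: the dominant energy condition -/
  energy : ∀ p ∈ S.G, 0 ≤ S.Tuu p ∧ 0 ≤ S.Tuv p ∧ 0 ≤ S.Tvv p
  /-- II: the spacetime is a past subset of the rectangle -/
  past : ∀ p ∈ S.G, causalPast p ∩ K u₀ v₀ ⊆ S.G
  /-- III: `r` is bounded along the event horizon, with supremum `r₊` -/
  r_sup : IsLUB (S.r '' Cout v₀) rPlus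
  /-- IV: `m` is nonnegative along the event horizon -/
  m_nonneg : ∀ p ∈ Cout v₀, 0 ≤ S.m p
  /-- IV: `m` is bounded along the event horizon, with supremum `m₊` -/
  m_sup : IsLUB (S.m '' Cout v₀) mPlus
  /-- V: no anti-trapped surfaces initially -/
  ru_neg : ∀ p ∈ Cout v₀, S.ru p < 0
  /-- VI: `∂_v r > 0` along the event horizon -/
  rv_pos : ∀ p ∈ Cout v₀, 0 < S.rv p
  /-- VII: the extension principle -/
  extension : ∀ p ∈ closure S.regular, ∀ q ∈ closure S.regular ∩ chronologicalPast p,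
    (causalPast p ∩ causalFuture q) \ {p} ⊆ S.regular ∪ S.tube → p ∈ S.regular ∪ S.tube

end Spacetime

end SphericalSpacetime

end

/-!
The sign of `∂_v r` organises the argument. The Raychaudhuri equation in `u` gives `∂_u r < 0`
everywhere, and the one in `v` makes `Ω⁻² ∂_v r` nonincreasing in `v`: along `u = const`, once
`∂_v r` has vanished it stays nonpositive. The Einstein equations also yield the wave equation
`r ∂_u ∂_v r + ∂_u r ∂_v r = Ω² (r² Ω⁻² T_uv - 1/4)` (`wave_u`, `wave_v`). Where
`Ω⁻² T_uv ≤ c₀ < 1 / (4 r₊²)` its right side is negative, so `∂_u ∂_v r < 0` at those points of the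
tube that are limits of regular points, as long as they lie in `r ≥ r₊ - δ`. Close to the horizon
this holds automatically (`exists_strip`), because there `r` is close to `r₊` at some level `v = V`
and, in the regular region, increases in `v` from there on.

It follows that in a strip `0 ≤ u ≤ U` the causal past of a point of the tube is regular to its
left (`rv_pos_left`, `regular_of_lt`). Hence the tube is achronal and contains no ingoing segments.
By the extension principle, a path that leaves the regular region does so through the tube
(`exists_tube_of_path`), so the function `v - u` maps the tube onto an interval. Its inverse is
Lipschitz by achronality, and the tube is connected (`tube_isPreconnected`).

If some line `u = const` in the strip missed the tube, everything to the left of that line would be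
regular. The bounds on `T_uu / (∂_u r)²` and, on the horizon, on `-Ω⁻² ∂_u r` give a bound of
`-Ω⁻² ∂_u r` throughout (`neg_scaledRu_le`), and the wave equation in the form
`∂_v (-r ∂_u r) = Ω² (1/4 - r² Ω⁻² T_uv)` then makes `-r ∂_u r` grow at least linearly in `v`.
Its integral in `u` is bounded by `r₊² / 2`, a contradiction (`false_of_regular_strip`).
-/

namespace SphericalSpacetime

open Set Filter Topology

/-! ### Null derivatives on a region with boundary -/

lemma uniqueDiffOn_K {u v : ℝ} (hu : 0 < u) : UniqueDiffOn ℝ (K u v) :=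
  (uniqueDiffOn_Icc hu).prod (uniqueDiffOn_Ici v)

lemma contDiffOn_du {G : Set (ℝ × ℝ)} (hG : UniqueDiffOn ℝ G) {f : ℝ × ℝ → ℝ}
    (hf : ContDiffOn ℝ ∞ f G) : ContDiffOn ℝ ∞ (du G f) G :=
  (hf.fderivWithin hG (m := ∞) (by simp)).clm_apply contDiffOn_const

lemma contDiffOn_dv {G : Set (ℝ × ℝ)} (hG : UniqueDiffOn ℝ G) {f : ℝ × ℝ → ℝ}
    (hf : ContDiffOn ℝ ∞ f G) : ContDiffOn ℝ ∞ (dv G f) G :=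
  (hf.fderivWithin hG (m := ∞) (by simp)).clm_apply contDiffOn_const

lemma hasDerivWithinAt_du {G : Set (ℝ × ℝ)} {f : ℝ × ℝ → ℝ} (hf : ContDiffOn ℝ ∞ f G)
    {u v : ℝ} {s : Set ℝ} (hs : ∀ x ∈ s, (x, v) ∈ G) (hu : (u, v) ∈ G) :
    HasDerivWithinAt (fun x => f (x, v)) (du G f (u, v)) s u := by
  have h := (hf.differentiableOn (by simp) _ hu).hasFDerivWithinAt
  exact h.comp_hasDerivWithinAt (f := fun x => (x, v)) u
    ((hasDerivWithinAt_id _ _).prodMk (hasDerivWithinAt_const _ _ _)) hs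

lemma hasDerivWithinAt_dv {G : Set (ℝ × ℝ)} {f : ℝ × ℝ → ℝ} (hf : ContDiffOn ℝ ∞ f G)
    {u v : ℝ} {s : Set ℝ} (hs : ∀ x ∈ s, (u, x) ∈ G) (hv : (u, v) ∈ G) :
    HasDerivWithinAt (fun x => f (u, x)) (dv G f (u, v)) s v := by
  have h := (hf.differentiableOn (by simp) _ hv).hasFDerivWithinAt
  exact h.comp_hasDerivWithinAt (f := fun x => (u, x)) v
    ((hasDerivWithinAt_const _ _ _).prodMk (hasDerivWithinAt_id _ _)) hs

namespace Spacetime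

variable {u₀ v₀ : ℝ} (S : Spacetime u₀ v₀)

lemma subset_K : S.G ⊆ K u₀ v₀ := by
  obtain ⟨O, -, h⟩ := S.relOpen
  rw [h]; exact inter_subset_right

lemma uniqueDiffOn : UniqueDiffOn ℝ S.G := by
  obtain ⟨O, hO, h⟩ := S.relOpen
  rw [h, inter_comm]; exact (uniqueDiffOn_K S.u₀_pos).inter hO

lemma ru_smooth : ContDiffOn ℝ ∞ S.ru S.G := contDiffOn_du S.uniqueDiffOn S.r_smooth

lemma rv_smooth : ContDiffOn ℝ ∞ S.rv S.G := contDiffOn_dv S.uniqueDiffOn S.r_smooth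

lemma invSq_smooth : ContDiffOn ℝ ∞ (fun p => (S.Ω p ^ 2)⁻¹) S.G :=
  (S.Ω_smooth.pow 2).inv fun p hp => pow_ne_zero 2 (S.Ω_pos p hp).ne'

lemma scaledRu_smooth : ContDiffOn ℝ ∞ (fun p => (S.Ω p ^ 2)⁻¹ * S.ru p) S.G :=
  S.invSq_smooth.mul S.ru_smooth

lemma scaledRv_smooth : ContDiffOn ℝ ∞ (fun p => (S.Ω p ^ 2)⁻¹ * S.rv p) S.G :=
  S.invSq_smooth.mul S.rv_smooth

lemma scaledTuv_smooth : ContDiffOn ℝ ∞ S.scaledTuv S.G := S.invSq_smooth.mul S.Tuv_smooth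

variable {S}

lemma mem_of_le {rPlus mPlus : ℝ} (hS : S.IsBlackHole rPlus mPlus) {u v u' v' : ℝ}
    (h : (u, v) ∈ S.G) (hu' : 0 ≤ u') (hu : u' ≤ u) (hv' : v₀ ≤ v') (hv : v' ≤ v) :
    (u', v') ∈ S.G :=
  hS.past _ h ⟨⟨hu, hv⟩, ⟨⟨hu', hu.trans (S.subset_K h).1.2⟩, hv'⟩⟩

lemma nonneg_of_mem {u v : ℝ} (h : (u, v) ∈ S.G) : 0 ≤ u := (S.subset_K h).1.1

lemma le_of_mem {u v : ℝ} (h : (u, v) ∈ S.G) : v₀ ≤ v := (S.subset_K h).2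

lemma Cout_mem {v : ℝ} (hv : v₀ ≤ v) : ((0 : ℝ), v) ∈ Cout v₀ := ⟨rfl, hv⟩

lemma nhdsWithin_eq {p : ℝ × ℝ} (hp : p ∈ S.G) : 𝓝[S.G] p = 𝓝[K u₀ v₀] p := by
  obtain ⟨O, hO, h⟩ := S.relOpen
  rw [h] at hp ⊢
  rw [inter_comm]
  exact nhdsWithin_inter_of_mem' (mem_nhdsWithin_of_mem_nhds (hO.mem_nhds hp.1))

lemma eventually_mem {p : ℝ × ℝ} (hp : p ∈ S.G) : ∀ᶠ q in 𝓝[K u₀ v₀] p, q ∈ S.G := by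
  rw [← nhdsWithin_eq hp]; exact self_mem_nhdsWithin

lemma eventually_regular {p : ℝ × ℝ} (hp : p ∈ S.regular) :
    ∀ᶠ q in 𝓝[K u₀ v₀] p, q ∈ S.regular := by
  have h1 := (S.rv_smooth.continuousOn p hp.1).eventually (lt_mem_nhds hp.2.1)
  have h2 := (S.ru_smooth.continuousOn p hp.1).eventually (gt_mem_nhds hp.2.2)
  rw [nhdsWithin_eq hp.1] at h1 h2
  filter_upwards [eventually_mem hp.1, h1, h2] with q a b c using ⟨a, b, c⟩

/-! ### Consequences of the Raychaudhuri equations -/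

section

variable {rPlus mPlus : ℝ} (hS : S.IsBlackHole rPlus mPlus)
include hS

lemma ru_neg {p : ℝ × ℝ} (hp : p ∈ S.G) : S.ru p < 0 := by
  obtain ⟨u, v⟩ := p
  have hu := nonneg_of_mem hp
  have hv := le_of_mem hp
  have hmem : ∀ x ∈ Icc 0 u, (x, v) ∈ S.G := fun x hx => mem_of_le hS hp hx.1 hx.2 hv le_rfl
  have hanti : AntitoneOn (fun x => (S.Ω (x, v) ^ 2)⁻¹ * S.ru (x, v)) (Icc 0 u) := by
    refine antitoneOn_of_hasDerivWithinAt_nonpos (convex_Icc _ _)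
      (f' := fun x => du S.G (fun p => (S.Ω p ^ 2)⁻¹ * S.ru p) (x, v))
      (fun x hx => (hasDerivWithinAt_du S.scaledRu_smooth hmem (hmem x hx)).continuousWithinAt)
      (fun x hx => (hasDerivWithinAt_du S.scaledRu_smooth hmem
        (hmem x (interior_subset hx))).mono interior_subset) ?_
    intro x hx
    have hx' := hmem x (interior_subset hx)
    have := S.raychaudhuri_u _ hx'
    change du S.G (fun x => (S.Ω x ^ 2)⁻¹ * du S.G S.r x) (x, v) ≤ 0
    rw [this]
    have h1 := S.r_nonneg _ hx'
    have h2 := S.Ω_pos _ hx'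
    have h3 := (hS.energy _ hx').1
    have : 0 ≤ S.r (x, v) * (S.Ω (x, v) ^ 2)⁻¹ * S.Tuu (x, v) := by positivity
    linarith
  have h := hanti ⟨le_rfl, hu⟩ ⟨hu, le_rfl⟩ hu
  have h0 := hS.ru_neg _ (Cout_mem hv)
  have hΩ0 := S.Ω_pos _ (hmem 0 ⟨le_rfl, hu⟩)
  have hΩ := S.Ω_pos _ hp
  have : (S.Ω (0, v) ^ 2)⁻¹ * S.ru (0, v) < 0 := mul_neg_of_pos_of_neg (by positivity) h0
  have h' := lt_of_le_of_lt h this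
  exact (pos_iff_neg_of_mul_neg h').1 (by positivity)

lemma scaledRv_antitone {u v : ℝ} (hp : (u, v) ∈ S.G) :
    AntitoneOn (fun x => (S.Ω (u, x) ^ 2)⁻¹ * S.rv (u, x)) (Icc v₀ v) := by
  have hu := nonneg_of_mem hp
  have hmem : ∀ x ∈ Icc v₀ v, (u, x) ∈ S.G := fun x hx => mem_of_le hS hp hu le_rfl hx.1 hx.2
  refine antitoneOn_of_hasDerivWithinAt_nonpos (convex_Icc _ _)
    (f' := fun x => dv S.G (fun p => (S.Ω p ^ 2)⁻¹ * S.rv p) (u, x))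
    (fun x hx => (hasDerivWithinAt_dv S.scaledRv_smooth hmem (hmem x hx)).continuousWithinAt)
    (fun x hx => (hasDerivWithinAt_dv S.scaledRv_smooth hmem
      (hmem x (interior_subset hx))).mono interior_subset) ?_
  intro x hx
  have hx' := hmem x (interior_subset hx)
  have := S.raychaudhuri_v _ hx'
  change dv S.G (fun x => (S.Ω x ^ 2)⁻¹ * dv S.G S.r x) (u, x) ≤ 0
  rw [this]
  have h1 := S.r_nonneg _ hx'
  have h2 := S.Ω_pos _ hx'
  have h3 := (hS.energy _ hx').2.2
  have : 0 ≤ S.r (u, x) * (S.Ω (u, x) ^ 2)⁻¹ * S.Tvv (u, x) := by positivity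
  linarith

lemma rv_nonneg_below {u v w : ℝ} (hp : (u, v) ∈ S.G) (h : 0 ≤ S.rv (u, v)) (hw : v₀ ≤ w)
    (hwv : w ≤ v) : 0 ≤ S.rv (u, w) := by
  have h1 := scaledRv_antitone hS hp ⟨hw, hwv⟩ ⟨hw.trans hwv, le_rfl⟩ hwv
  have hΩ := S.Ω_pos _ hp
  have hΩ' := S.Ω_pos _ (mem_of_le hS hp (nonneg_of_mem hp) le_rfl hw hwv)
  have : 0 ≤ (S.Ω (u, w) ^ 2)⁻¹ * S.rv (u, w) := le_trans (by positivity) h1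
  exact nonneg_of_mul_nonneg_right this (by positivity)

lemma rv_pos_below {u v w : ℝ} (hp : (u, v) ∈ S.G) (h : 0 < S.rv (u, v)) (hw : v₀ ≤ w)
    (hwv : w ≤ v) : 0 < S.rv (u, w) := by
  have h1 := scaledRv_antitone hS hp ⟨hw, hwv⟩ ⟨hw.trans hwv, le_rfl⟩ hwv
  have hΩ := S.Ω_pos _ hp
  have hΩ' := S.Ω_pos _ (mem_of_le hS hp (nonneg_of_mem hp) le_rfl hw hwv)
  have : 0 < (S.Ω (u, w) ^ 2)⁻¹ * S.rv (u, w) := lt_of_lt_of_le (by positivity) h1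
  exact (pos_iff_pos_of_mul_pos this).1 (by positivity)

lemma mem_regular_iff {p : ℝ × ℝ} : p ∈ S.regular ↔ p ∈ S.G ∧ 0 < S.rv p :=
  ⟨fun h => ⟨h.1, h.2.1⟩, fun h => ⟨h.1, h.2, ru_neg hS h.1⟩⟩

lemma mem_tube_iff {p : ℝ × ℝ} : p ∈ S.tube ↔ p ∈ S.G ∧ S.rv p = 0 :=
  ⟨fun h => ⟨h.1, h.2.1⟩, fun h => ⟨h.1, h.2, ru_neg hS h.1⟩⟩

lemma mem_regular_union_tube_iff {p : ℝ × ℝ} :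
    p ∈ S.regular ∪ S.tube ↔ p ∈ S.G ∧ 0 ≤ S.rv p := by
  rw [mem_union, mem_regular_iff hS, mem_tube_iff hS, le_iff_lt_or_eq, eq_comm (a := (0 : ℝ))]
  tauto

lemma Cout_subset_regular : Cout v₀ ⊆ S.regular := fun p hp =>
  (mem_regular_iff hS).2 ⟨S.Cout_subset hp, hS.rv_pos p hp⟩

lemma r_antitone {u v : ℝ} (hp : (u, v) ∈ S.G) :
    AntitoneOn (fun x => S.r (x, v)) (Icc 0 u) := by
  have hmem : ∀ x ∈ Icc 0 u, (x, v) ∈ S.G :=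
    fun x hx => mem_of_le hS hp hx.1 hx.2 (le_of_mem hp) le_rfl
  exact antitoneOn_of_hasDerivWithinAt_nonpos (convex_Icc _ _) (f' := fun x => S.ru (x, v))
    (fun x hx => (hasDerivWithinAt_du S.r_smooth hmem (hmem x hx)).continuousWithinAt)
    (fun x hx => (hasDerivWithinAt_du S.r_smooth hmem
      (hmem x (interior_subset hx))).mono interior_subset)
    (fun x hx => (ru_neg hS (hmem x (interior_subset hx))).le)

lemma r_monotone {u v : ℝ} (hp : (u, v) ∈ S.G) (h : 0 ≤ S.rv (u, v)) :
    MonotoneOn (fun x => S.r (u, x)) (Icc v₀ v) := by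
  have hmem : ∀ x ∈ Icc v₀ v, (u, x) ∈ S.G :=
    fun x hx => mem_of_le hS hp (nonneg_of_mem hp) le_rfl hx.1 hx.2
  exact monotoneOn_of_hasDerivWithinAt_nonneg (convex_Icc _ _) (f' := fun x => S.rv (u, x))
    (fun x hx => (hasDerivWithinAt_dv S.r_smooth hmem (hmem x hx)).continuousWithinAt)
    (fun x hx => (hasDerivWithinAt_dv S.r_smooth hmem
      (hmem x (interior_subset hx))).mono interior_subset)
    (fun x hx => rv_nonneg_below hS hp h (interior_subset hx).1 (interior_subset hx).2)

lemma r_le_rPlus {p : ℝ × ℝ} (hp : p ∈ S.G) : S.r p ≤ rPlus := by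
  obtain ⟨u, v⟩ := p
  have hu := nonneg_of_mem hp
  exact (r_antitone hS hp ⟨le_rfl, hu⟩ ⟨hu, le_rfl⟩ hu).trans
    (hS.r_sup.1 ⟨_, Cout_mem (le_of_mem hp), rfl⟩)

lemma rPlus_pos : 0 < rPlus :=
  (S.r_pos _ (Or.inr (Cout_mem le_rfl))).trans_le
    (r_le_rPlus hS (S.Cout_subset (Cout_mem le_rfl)))

end

/-! ### The wave equation for `r` -/

lemma fderivWithin_hawkingMass {p : ℝ × ℝ} (hp : p ∈ S.G) {A : ℝ × ℝ → ℝ} {B : ℝ × ℝ → ℝ}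
    (hA : ContDiffOn ℝ ∞ A S.G) (hB : ContDiffOn ℝ ∞ B S.G)
    (hm : ∀ x, hawkingMass S.G S.Ω S.r x = S.r x * (1 / 2 + 2 * (A x * B x))) :
    fderivWithin ℝ (hawkingMass S.G S.Ω S.r) S.G p =
      S.r p • ((2 : ℝ) • (A p • fderivWithin ℝ B S.G p + B p • fderivWithin ℝ A S.G p)) +
        (1 / 2 + 2 * (A p * B p)) • fderivWithin ℝ S.r S.G p := by
  have hd {f : ℝ × ℝ → ℝ} (hf : ContDiffOn ℝ ∞ f S.G) :=
    (hf.differentiableOn (by simp) _ hp).hasFDerivWithinAt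
  have := (hd S.r_smooth).mul ((((hd hA).mul (hd hB)).const_mul 2).const_add (1 / 2))
  rw [funext hm]
  exact this.fderivWithin (S.uniqueDiffOn p hp)

/-- The `u`-equation for the Hawking mass, combined with the Raychaudhuri equation, is the wave
equation for `r` multiplied by `∂_u r`. -/
lemma wave_u {p : ℝ × ℝ} (hp : p ∈ S.G) (hru : S.ru p ≠ 0) :
    S.r p * du S.G S.rv p + S.ru p * S.rv p = S.Ω p ^ 2 * (S.r p ^ 2 * S.scaledTuv p - 1 / 4) := by
  have h := S.mass_u p hp
  have hR := S.raychaudhuri_u p hp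
  have hΩ := (S.Ω_pos p hp).ne'
  rw [du, fderivWithin_hawkingMass hp S.scaledRu_smooth S.rv_smooth
    (fun x => by simp only [hawkingMass, ru, rv]; ring)] at h
  change du S.G (fun x => (S.Ω x ^ 2)⁻¹ * S.ru x) p = _ at hR
  change S.r p * (2 * ((S.Ω p ^ 2)⁻¹ * S.ru p * du S.G S.rv p +
    S.rv p * du S.G (fun x => (S.Ω x ^ 2)⁻¹ * S.ru x) p)) +
    (1 / 2 + 2 * ((S.Ω p ^ 2)⁻¹ * S.ru p * S.rv p)) * S.ru p =
    2 * S.r p ^ 2 * (S.Ω p ^ 2)⁻¹ * (S.Tuv p * S.ru p - S.Tuu p * S.rv p) at h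
  rw [hR] at h
  simp only [scaledTuv]
  field_simp at h ⊢
  apply mul_left_cancel₀ hru
  linear_combination h

/-- The `v`-equation for the Hawking mass, combined with the Raychaudhuri equation, is the wave
equation for `r` multiplied by `∂_v r`. -/
lemma wave_v {p : ℝ × ℝ} (hp : p ∈ S.G) (hrv : S.rv p ≠ 0) :
    S.r p * dv S.G S.ru p + S.rv p * S.ru p = S.Ω p ^ 2 * (S.r p ^ 2 * S.scaledTuv p - 1 / 4) := by
  have h := S.mass_v p hp
  have hR := S.raychaudhuri_v p hp
  have hΩ := (S.Ω_pos p hp).ne'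
  rw [dv, fderivWithin_hawkingMass hp S.scaledRv_smooth S.ru_smooth
    (fun x => by simp only [hawkingMass, ru, rv]; ring)] at h
  change dv S.G (fun x => (S.Ω x ^ 2)⁻¹ * S.rv x) p = _ at hR
  change S.r p * (2 * ((S.Ω p ^ 2)⁻¹ * S.rv p * dv S.G S.ru p +
    S.ru p * dv S.G (fun x => (S.Ω x ^ 2)⁻¹ * S.rv x) p)) +
    (1 / 2 + 2 * ((S.Ω p ^ 2)⁻¹ * S.rv p * S.ru p)) * S.rv p =
    2 * S.r p ^ 2 * (S.Ω p ^ 2)⁻¹ * (S.Tuv p * S.rv p - S.Tvv p * S.ru p) at h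
  rw [hR] at h
  simp only [scaledTuv]
  field_simp at h ⊢
  apply mul_left_cancel₀ hrv
  linear_combination h

/-! ### The sign of `∂_v r` to the past of a point of the tube -/

/-- The strip `[0, U] × [v₀, ∞)` is one in which `∂_u ∂_v r < 0` at the points of the tube that
border on the regular region, and its initial edge is regular. -/
structure IsGoodStrip (S : Spacetime u₀ v₀) (U : ℝ) : Prop where
  le : U ≤ u₀
  Cin_regular : ∀ u, 0 ≤ u → u ≤ U → (u, v₀) ∈ S.regular
  du_rv_neg : ∀ p ∈ S.tube, p ∈ closure S.regular → p.1 ≤ U → du S.G S.rv p < 0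

section

variable {rPlus mPlus U : ℝ} (hS : S.IsBlackHole rPlus mPlus) (hU : S.IsGoodStrip U)
include hS

/-- Where `∂_u ∂_v r < 0` along an ingoing segment, `∂_v r` is strictly decreasing along it. -/
lemma rv_lt_of_du_neg {u₁ u₂ v : ℝ} (hp : (u₂, v) ∈ S.G) (h0 : 0 ≤ u₁) (h12 : u₁ < u₂)
    (h : ∀ x ∈ Ioo u₁ u₂, du S.G S.rv (x, v) < 0) : S.rv (u₂, v) < S.rv (u₁, v) := by
  have hmem : ∀ x ∈ Icc u₁ u₂, (x, v) ∈ S.G :=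
    fun x hx => mem_of_le hS hp (h0.trans hx.1) hx.2 (le_of_mem hp) le_rfl
  have hanti : StrictAntiOn (fun x => S.rv (x, v)) (Icc u₁ u₂) := by
    refine strictAntiOn_of_hasDerivWithinAt_neg (convex_Icc _ _)
      (f' := fun x => du S.G S.rv (x, v))
      (fun x hx => (hasDerivWithinAt_du S.rv_smooth hmem (hmem x hx)).continuousWithinAt)
      (fun x hx => (hasDerivWithinAt_du S.rv_smooth hmem
        (hmem x (interior_subset hx))).mono interior_subset) ?_
    intro x hx
    rw [interior_Icc] at hx
    exact h x hx
  exact hanti ⟨le_rfl, h12.le⟩ ⟨h12.le, le_rfl⟩ h12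

include hU

/-- There is no trapped or marginally trapped point on the ingoing segment that ends at a point
with `∂_v r ≥ 0`. Otherwise consider, among the points with `∂_v r ≤ 0` in the rectangle to the
past of that point, one with the least `v`: it is a limit of regular points, so `∂_u ∂_v r < 0`
near it, which makes `∂_v r` negative on its right. -/
lemma rv_pos_left {u₁ u₂ v : ℝ} (hp : (u₂, v) ∈ S.G) (hrv : 0 ≤ S.rv (u₂, v)) (hu : u₂ ≤ U)
    (h0 : 0 ≤ u₁) (h12 : u₁ < u₂) : 0 < S.rv (u₁, v) := by
  by_contra! hneg
  have hv := le_of_mem hp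
  set B : Set (ℝ × ℝ) := Icc 0 u₂ ×ˢ Icc v₀ v
  have hBG : B ⊆ S.G := fun q hq => mem_of_le hS hp hq.1.1 hq.1.2 hq.2.1 hq.2.2
  have hBc : IsCompact B := isCompact_Icc.prod isCompact_Icc
  set E : Set (ℝ × ℝ) := {q ∈ B | q.1 < u₂ ∧ S.rv q ≤ 0}
  have hEB : closure E ⊆ B := closure_minimal (fun q hq => hq.1) hBc.isClosed
  have hErv : ∀ q ∈ closure E, S.rv q ≤ 0 := by
    intro q hq
    have hc : ContinuousWithinAt S.rv E q :=
      (S.rv_smooth.continuousOn q (hBG (hEB hq))).mono fun x hx => hBG hx.1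
    have := mem_closure_iff_nhdsWithin_neBot.1 hq
    exact le_of_tendsto hc (eventually_mem_nhdsWithin.mono fun x hx => hx.2.2)
  have hne : (closure E).Nonempty :=
    ⟨(u₁, v), subset_closure ⟨⟨⟨h0, h12.le⟩, ⟨hv, le_rfl⟩⟩, h12, hneg⟩⟩
  obtain ⟨⟨a, b⟩, hq, hmin⟩ := (hBc.of_isClosed_subset isClosed_closure hEB).exists_isMinOn hne
    continuous_snd.continuousOn
  have hmin' : ∀ q ∈ closure E, b ≤ q.2 := fun q hq => hmin hq
  obtain ⟨⟨ha0, hau⟩, ⟨hb0, hbv⟩⟩ := hEB hq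
  have hqrv := hErv _ hq
  simp only at ha0 hau hb0 hbv
  have hb0' : v₀ < b := by
    rcases hb0.lt_or_eq with h | h
    · exact h
    · have := (hU.Cin_regular a ha0 (hau.trans hu)).2.1
      have e : ((a, b) : ℝ × ℝ) = (a, v₀) := Prod.ext rfl h.symm
      rw [e] at hqrv
      exact absurd hqrv this.not_ge
  have hu0 : 0 < u₂ := h0.trans_lt h12
  -- Below the minimal level everything to the left of `u₂` is regular.
  have hreg : Ico 0 u₂ ×ˢ Ico v₀ b ⊆ S.regular := by
    rintro ⟨x, y⟩ ⟨⟨hx0, hx⟩, hy0, hy⟩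
    simp only at hx0 hx hy0 hy
    have hB : (x, y) ∈ B := ⟨⟨hx0, hx.le⟩, hy0, (hy.trans_le hbv).le⟩
    refine (mem_regular_iff hS).2 ⟨hBG hB, ?_⟩
    by_contra! h
    exact absurd (hmin' _ (subset_closure ⟨hB, hx, h⟩)) (not_le.2 hy)
  have hcl : Icc 0 u₂ ×ˢ Icc v₀ b ⊆ closure S.regular := by
    refine Subset.trans ?_ (closure_mono hreg)
    rw [closure_prod_eq, closure_Ico hu0.ne, closure_Ico hb0'.ne]
  have hlevel : ∀ x ∈ Icc 0 u₂, 0 ≤ S.rv (x, b) := by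
    intro x hx
    have hxB : (x, b) ∈ B := ⟨hx, hb0, hbv⟩
    have hc : ContinuousWithinAt S.rv (Ico 0 u₂ ×ˢ Ico v₀ b) (x, b) :=
      (S.rv_smooth.continuousOn _ (hBG hxB)).mono fun q hq => (hreg hq).1
    have hxcl : (x, b) ∈ closure (Ico 0 u₂ ×ˢ Ico v₀ b) := by
      rw [closure_prod_eq, closure_Ico hu0.ne, closure_Ico hb0'.ne]
      exact ⟨hx, hb0, le_rfl⟩
    have := mem_closure_iff_nhdsWithin_neBot.1 hxcl
    exact ge_of_tendsto hc (eventually_mem_nhdsWithin.mono fun q hq => (hreg hq).2.1.le)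
  have hq0 : S.rv (a, b) = 0 := le_antisymm hqrv (hlevel a ⟨ha0, hau⟩)
  have hduneg : du S.G S.rv (a, b) < 0 :=
    hU.du_rv_neg _ ((mem_tube_iff hS).2 ⟨hBG (hEB hq), hq0⟩)
      (hcl ⟨⟨ha0, hau⟩, hb0, le_rfl⟩) (hau.trans hu)
  have hcont : ContinuousWithinAt (du S.G S.rv) B (a, b) :=
    ((contDiffOn_du S.uniqueDiffOn S.rv_smooth).continuousOn _ (hBG (hEB hq))).mono hBG
  obtain ⟨η, hη, hball⟩ := Metric.mem_nhdsWithin_iff.1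
    (hcont.eventually (gt_mem_nhds hduneg))
  have hdu : ∀ x y, x ∈ Icc 0 u₂ → y ∈ Icc v₀ v → |x - a| < η → |y - b| < η →
      du S.G S.rv (x, y) < 0 := by
    intro x y hx hy h1 h2
    refine hball ⟨?_, hx, hy⟩
    rw [Metric.mem_ball, Prod.dist_eq]
    exact max_lt (by simpa [Real.dist_eq] using h1) (by simpa [Real.dist_eq] using h2)
  rcases hau.lt_or_eq with hlt | heq
  · -- Just to the right of an interior minimal point, `∂_v r` is negative.
    set x := min u₂ (a + η / 2)
    have hax : a < x := lt_min hlt (by linarith)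
    have hxu : x ≤ u₂ := min_le_left _ _
    have hxη : x ≤ a + η / 2 := min_le_right _ _
    have h := rv_lt_of_du_neg hS (hBG (show (x, b) ∈ B from ⟨⟨ha0.trans hax.le, hxu⟩, hb0, hbv⟩))
      ha0 hax (fun y hy => hdu y b ⟨ha0.trans hy.1.le, hy.2.le.trans hxu⟩ ⟨hb0, hbv⟩
        (by rw [abs_lt]; constructor <;> linarith [hy.1, hy.2]) (by simpa using hη))
    linarith [hlevel x ⟨ha0.trans hax.le, hxu⟩]
  · -- A minimal point on the right edge is a limit of points with `∂_v r ≤ 0`, to the right of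
    -- which `∂_v r` would be negative on that edge.
    obtain ⟨⟨x, y⟩, ⟨hxB, hxu, hxrv⟩, hd⟩ := Metric.mem_closure_iff.1 hq η hη
    rw [dist_comm, Prod.dist_eq, max_lt_iff, Real.dist_eq, Real.dist_eq] at hd
    simp only at hxu hd
    have hxB1 : x ∈ Icc 0 u₂ := hxB.1
    have hyB : y ∈ Icc v₀ v := hxB.2
    have h := rv_lt_of_du_neg hS (hBG (show (u₂, y) ∈ B from ⟨⟨hu0.le, le_rfl⟩, hyB⟩))
      hxB1.1 hxu (fun z hz => hdu z y ⟨hxB1.1.trans hz.1.le, hz.2.le⟩ hyB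
        (by have := abs_lt.1 hd.1
            rw [abs_lt]; constructor <;> linarith [hz.1, hz.2, this.1]) hd.2)
    linarith [rv_nonneg_below hS hp hrv hyB.1 hyB.2]

/-- The part of the causal past of a regular or marginally trapped point strictly to its left
is regular. -/
lemma regular_of_lt {u₁ u₂ v₁ v₂ : ℝ} (hp : (u₂, v₂) ∈ S.regular ∪ S.tube) (hu : u₂ ≤ U)
    (h0 : 0 ≤ u₁) (h12 : u₁ < u₂) (hv₁ : v₀ ≤ v₁) (hv : v₁ ≤ v₂) : (u₁, v₁) ∈ S.regular := by
  obtain ⟨hG, hrv⟩ := (mem_regular_union_tube_iff hS).1 hp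
  have h1 := rv_pos_left hS hU hG hrv hu h0 h12
  exact (mem_regular_iff hS).2 ⟨mem_of_le hS hG h0 h12.le hv₁ hv,
    rv_pos_below hS (mem_of_le hS hG h0 h12.le (le_of_mem hG) le_rfl) h1 hv₁ hv⟩

lemma regular_of_le {u₁ u₂ v₁ v₂ : ℝ} (hp : (u₂, v₂) ∈ S.regular) (hu : u₂ ≤ U)
    (h0 : 0 ≤ u₁) (h12 : u₁ ≤ u₂) (hv₁ : v₀ ≤ v₁) (hv : v₁ ≤ v₂) : (u₁, v₁) ∈ S.regular := by
  rcases h12.lt_or_eq with h | rfl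
  · exact regular_of_lt hS hU (Or.inl hp) hu h0 h hv₁ hv
  · exact (mem_regular_iff hS).2 ⟨mem_of_le hS hp.1 h0 le_rfl hv₁ hv,
      rv_pos_below hS hp.1 hp.2.1 hv₁ hv⟩

lemma tube_eq_of_snd_eq {u₁ u₂ v : ℝ} (h₁ : (u₁, v) ∈ S.tube) (h₂ : (u₂, v) ∈ S.tube)
    (hu : u₂ ≤ U) : ¬ u₁ < u₂ := fun h => by
  have := regular_of_lt hS hU (Or.inr h₂) hu (nonneg_of_mem h₁.1) h (le_of_mem h₁.1) le_rfl
  exact this.2.1.ne' h₁.2.1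

lemma tube_achronal : Achronal (S.tube ∩ {p | p.1 ≤ U}) := by
  rintro ⟨u₂, v₂⟩ ⟨h₂, hu⟩ ⟨u₁, v₁⟩ ⟨h₁, -⟩ ⟨hlt, hv⟩
  have := regular_of_lt hS hU (Or.inr h₂) hu (nonneg_of_mem h₁.1) hlt (le_of_mem h₁.1) hv.le
  exact this.2.1.ne' h₁.2.1

/-! ### The extension principle and first exit from the regular region -/

/-- If the chronological past of `p` in the rectangle is regular, then `p` is regular or
marginally trapped. A point of `J⁻(p)` outside the spacetime with the least `u + v` would violate
the extension principle. -/
lemma mem_of_chronologicalPast_subset {u v : ℝ} (hu0 : 0 < u) (hu : u ≤ U) (hv : v₀ < v)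
    (h : Ico 0 u ×ˢ Ico v₀ v ⊆ S.regular) : (u, v) ∈ S.regular ∪ S.tube := by
  have hcl : Icc 0 u ×ˢ Icc v₀ v ⊆ closure (Ico 0 u ×ˢ Ico v₀ v) := by
    rw [closure_prod_eq, closure_Ico hu0.ne, closure_Ico hv.ne]
  have hmem : ∀ q ∈ Icc 0 u ×ˢ Icc v₀ v, q ∈ S.G → q ∈ S.regular ∪ S.tube := by
    intro q hq hqG
    refine (mem_regular_union_tube_iff hS).2 ⟨hqG, ?_⟩
    have hc : ContinuousWithinAt S.rv (Ico 0 u ×ˢ Ico v₀ v) q :=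
      (S.rv_smooth.continuousOn _ hqG).mono fun x hx => (h hx).1
    have := mem_closure_iff_nhdsWithin_neBot.1 (hcl hq)
    exact ge_of_tendsto hc (eventually_mem_nhdsWithin.mono fun x hx => (h hx).2.1.le)
  refine hmem _ ⟨⟨hu0.le, le_rfl⟩, hv.le, le_rfl⟩ ?_
  by_contra hnot
  obtain ⟨O, hO, hGO⟩ := S.relOpen
  have hK : Icc 0 u ×ˢ Icc v₀ v ⊆ K u₀ v₀ := fun q hq =>
    ⟨⟨hq.1.1, hq.1.2.trans (hu.trans hU.le)⟩, hq.2.1⟩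
  have hcomp : IsCompact ((Icc 0 u ×ˢ Icc v₀ v) \ O) :=
    (isCompact_Icc.prod isCompact_Icc).diff hO
  have hpnot : (u, v) ∉ O := fun hp => hnot (by
    rw [hGO]; exact ⟨hp, hK ⟨⟨hu0.le, le_rfl⟩, hv.le, le_rfl⟩⟩)
  obtain ⟨⟨a, b⟩, ⟨⟨⟨ha0, hau⟩, hb0, hbv⟩, habO⟩, hmin⟩ := hcomp.exists_isMinOn
    ⟨(u, v), ⟨⟨hu0.le, le_rfl⟩, hv.le, le_rfl⟩, hpnot⟩
    (f := fun q : ℝ × ℝ => q.1 + q.2) (by fun_prop)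
  simp only at ha0 hau hb0 hbv
  have habG : (a, b) ∉ S.G := fun hG => habO (by rw [hGO] at hG; exact hG.1)
  have ha : 0 < a := ha0.lt_of_ne fun h0 => habG (S.Cout_subset ⟨h0.symm, hb0⟩)
  have hb : v₀ < b := hb0.lt_of_ne fun h0 => habG
    (S.Cin_subset ⟨⟨ha0, hau.trans (hu.trans hU.le)⟩, h0.symm⟩)
  have := hS.extension (a, b) (closure_mono h (hcl ⟨⟨ha0, hau⟩, hb0, hbv⟩)) (0, v₀)
    ⟨subset_closure (Cout_subset_regular hS (Cout_mem le_rfl)), ha, hb⟩ ?_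
  · exact habG ((mem_regular_union_tube_iff hS).1 this).1
  · rintro ⟨x, y⟩ ⟨⟨⟨hxa, hyb⟩, ⟨hx0, hy0⟩⟩, hne⟩
    simp only at hxa hyb hx0 hy0
    have hbox : (x, y) ∈ Icc 0 u ×ˢ Icc v₀ v := ⟨⟨hx0, hxa.trans hau⟩, hy0, hyb.trans hbv⟩
    refine hmem _ hbox ?_
    by_contra hxG
    have hxO : (x, y) ∉ O := fun hx => hxG (by rw [hGO]; exact ⟨hx, hK hbox⟩)
    have hsum : a + b ≤ x + y := hmin (show (x, y) ∈ _ from ⟨hbox, hxO⟩)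
    exact hne (by
      rw [mem_singleton_iff, Prod.mk.injEq]; constructor <;> linarith)

/-- A continuous path in the strip that starts in the regular region and leaves it meets the tube:
the extension principle applies at the first exit point. -/
lemma exists_tube_of_path {γ : ℝ → ℝ × ℝ} (hγ : Continuous γ) {a b : ℝ} (hab : a ≤ b)
    (hK : ∀ s ∈ Icc a b, γ s ∈ K U v₀) (ha : γ a ∈ S.regular) (hb : γ b ∉ S.regular) :
    ∃ s ∈ Icc a b, γ s ∈ S.tube := by
  set E : Set ℝ := {s ∈ Icc a b | γ s ∉ S.regular}
  have hEne : E.Nonempty := ⟨b, ⟨hab, le_rfl⟩, hb⟩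
  have hEbdd : BddBelow E := ⟨a, fun s hs => hs.1.1⟩
  have hKK : K U v₀ ⊆ K u₀ v₀ := fun q hq => ⟨⟨hq.1.1, hq.1.2.trans hU.le⟩, hq.2⟩
  have hmaps : MapsTo γ (Icc a b) (K u₀ v₀) := fun s hs => hKK (hK s hs)
  set c := sInf E
  have hac : a ≤ c := le_csInf hEne fun s hs => hs.1.1
  have hcb : c ≤ b := csInf_le hEbdd ⟨⟨hab, le_rfl⟩, hb⟩
  have hcnot : γ c ∉ S.regular := by
    intro hreg
    have hev : ∀ᶠ s in 𝓝[Icc a b] c, γ s ∈ S.regular :=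
      (hγ.continuousWithinAt.tendsto_nhdsWithin hmaps).eventually (eventually_regular hreg)
    have hcE : c ∈ closure E := csInf_mem_closure hEne hEbdd
    have := mem_closure_iff_nhdsWithin_neBot.1 hcE
    have : ∀ᶠ s in 𝓝[E] c, γ s ∈ S.regular :=
      hev.filter_mono (nhdsWithin_mono _ fun s hs => hs.1)
    obtain ⟨s, hs, hsE⟩ := (this.and eventually_mem_nhdsWithin).exists
    exact hsE.2 hs
  have hac' : a < c := hac.lt_of_ne fun h => hcnot (h ▸ ha)
  obtain ⟨⟨h0, h1⟩, h2⟩ := hK c ⟨hac, hcb⟩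
  have hu0 : 0 < (γ c).1 := h0.lt_of_ne fun h => hcnot (Cout_subset_regular hS ⟨h.symm, h2⟩)
  have hv0 : v₀ < (γ c).2 := lt_of_le_of_ne h2 fun h => hcnot (by
    have := hU.Cin_regular _ h0 h1
    have e : γ c = ((γ c).1, v₀) := Prod.ext rfl h.symm
    rwa [← e] at this)
  refine ⟨c, ⟨hac, hcb⟩, ?_⟩
  have := mem_of_chronologicalPast_subset hS hU hu0 h1 hv0 ?_
  · exact this.resolve_left hcnot
  · rintro ⟨x, y⟩ ⟨⟨hx0, hx⟩, hy0, hy⟩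
    have hopen : ∀ᶠ s in 𝓝[<] c, x < (γ s).1 ∧ y < (γ s).2 :=
      (((hγ.fst.continuousAt).eventually (lt_mem_nhds hx)).and
        ((hγ.snd.continuousAt).eventually (lt_mem_nhds hy))).filter_mono nhdsWithin_le_nhds
    obtain ⟨s, ⟨hsx, hsy⟩, hsa, hsc⟩ := (hopen.and (Ioo_mem_nhdsLT hac')).exists
    have hsI : s ∈ Icc a b := ⟨hsa.le, hsc.le.trans hcb⟩
    have hsreg : γ s ∈ S.regular := by
      by_contra h
      exact absurd (csInf_le hEbdd ⟨hsI, h⟩) (not_le.2 hsc)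
    exact regular_of_le hS hU hsreg (hK s hsI).1.2 hx0 hsx.le hy0 hsy.le

/-- The tube in the strip meets every diagonal `v - u = t` in at most one point, the values of `t`
that occur form an interval, and the point depends continuously on `t` by achronality. -/
lemma tube_isPreconnected (V : ℝ) : IsPreconnected (S.tube ∩ K U V) := by
  set T := S.tube ∩ K U V
  have hach : ∀ p ∈ T, ∀ q ∈ T, p.2 - p.1 ≤ q.2 - q.1 → q.1 ≤ p.1 ∧ p.2 ≤ q.2 := by
    intro p hp q hq hpq
    have h1 := tube_achronal hS hU q ⟨hq.1, hq.2.1.2⟩ p ⟨hp.1, hp.2.1.2⟩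
    have h2 := tube_achronal hS hU p ⟨hp.1, hp.2.1.2⟩ q ⟨hq.1, hq.2.1.2⟩
    simp only [chronologicalPast, mem_ofPred_eq, not_and, not_lt] at h1 h2
    constructor
    · by_contra! h
      linarith [h1 h]
    · by_contra! h
      have := h2 (by linarith)
      linarith
  set t : ℝ × ℝ → ℝ := fun p => p.2 - p.1
  have hex : ∀ s ∈ t '' T, ∃ p ∈ T, t p = s := fun s hs => hs
  choose! g hgT hgt using hex
  have hgT' : g '' (t '' T) = T := by
    apply Subset.antisymm
    · rintro _ ⟨s, hs, rfl⟩; exact hgT s hs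
    · intro p hp
      refine ⟨t p, mem_image_of_mem t hp, ?_⟩
      have hq := hgT _ (mem_image_of_mem t hp)
      have he : t (g (t p)) = t p := hgt _ (mem_image_of_mem t hp)
      have h1 := hach _ hq _ hp he.le
      have h2 := hach _ hp _ hq he.ge
      exact Prod.ext (le_antisymm h2.1 h1.1) (le_antisymm h1.2 h2.2)
  have hlip : LipschitzOnWith 1 g (t '' T) := by
    refine LipschitzOnWith.of_dist_le_mul ?_
    have key : ∀ x ∈ t '' T, ∀ y ∈ t '' T, x ≤ y → dist (g x) (g y) ≤ dist x y := by
      intro x hx y hy hxy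
      have ex : (g x).2 - (g x).1 = x := hgt x hx
      have ey : (g y).2 - (g y).1 = y := hgt y hy
      obtain ⟨h1, h2⟩ := hach _ (hgT x hx) _ (hgT y hy) (by rw [ex, ey]; exact hxy)
      rw [Prod.dist_eq, Real.dist_eq, Real.dist_eq, Real.dist_eq]
      apply max_le
      · rw [abs_of_nonneg (by linarith), abs_of_nonpos (by linarith)]; linarith
      · rw [abs_of_nonpos (by linarith), abs_of_nonpos (by linarith)]; linarith
    intro x hx y hy
    simp only [NNReal.coe_one, one_mul]
    rcases le_total x y with h | h
    · exact key x hx y hy h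
    · rw [dist_comm, dist_comm x]; exact key y hy x hx h
  have hord : OrdConnected (t '' T) := by
    refine ⟨?_⟩
    rintro _ ⟨⟨u₁, v₁⟩, hp₁, rfl⟩ _ ⟨⟨u₂, v₂⟩, hp₂, rfl⟩ s ⟨hs₁, hs₂⟩
    simp only [t] at hs₁ hs₂
    rcases hs₁.lt_or_eq with hs | hs
    swap
    · exact ⟨_, hp₁, hs⟩
    obtain ⟨⟨hu0, huU⟩, hVv⟩ := hp₁.2
    have hv0 := le_of_mem hp₁.1.1
    simp only [mem_Ici] at hu0 huU hVv
    -- The diagonal enters the rectangle at a regular point and, at `u = u₁`, lies above a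
    -- marginally trapped point.
    set a := max 0 (v₀ - s)
    have ha0 : 0 ≤ a := le_max_left _ _
    have hav : v₀ ≤ a + s := by linarith [le_max_right 0 (v₀ - s)]
    have hau : a ≤ u₁ := max_le hu0 (by linarith)
    obtain ⟨x, hx, hxT⟩ := exists_tube_of_path hS hU (γ := fun x => (x, x + s)) (by fun_prop) hau
      (fun x hx => ⟨⟨ha0.trans hx.1, hx.2.trans huU⟩, hav.trans (by linarith [hx.1])⟩)
      (by
        rcases le_total 0 (v₀ - s) with h | h
        · have : a = v₀ - s := max_eq_right h
          have h' := hU.Cin_regular a ha0 (hau.trans huU)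
          simpa [this] using h'
        · have : a = 0 := max_eq_left h
          simp only [this]
          exact Cout_subset_regular hS (Cout_mem (by linarith)))
      (fun hreg => by
        have := regular_of_le hS hU hreg huU hu0 le_rfl hv0 (by linarith : v₁ ≤ u₁ + s)
        exact this.2.1.ne' hp₁.1.2.1)
    refine ⟨(x, x + s), ⟨hxT, ⟨ha0.trans hx.1, hx.2.trans huU⟩, ?_⟩, by simp [t]⟩
    have h := tube_achronal hS hU _ ⟨hp₁.1, huU⟩ _ ⟨hxT, hx.2.trans huU⟩
    simp only [chronologicalPast, mem_ofPred_eq, not_and, not_lt] at h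
    change V ≤ x + s
    by_contra! hlt
    linarith [h (by linarith)]
  rw [← hgT']
  exact hord.isPreconnected.image g hlip.continuousOn

end

/-! ### Non-existence of a regular strip reaching `i⁺` -/

section

variable {rPlus mPlus : ℝ} (hS : S.IsBlackHole rPlus mPlus)
include hS

lemma sq_mul_le {c₀ : ℝ} (hc₀ : 0 ≤ c₀) {p : ℝ × ℝ} (hp : p ∈ S.G) (hT : S.scaledTuv p ≤ c₀) :
    S.r p ^ 2 * S.scaledTuv p ≤ rPlus ^ 2 * c₀ :=
  calc S.r p ^ 2 * S.scaledTuv p ≤ S.r p ^ 2 * c₀ := by gcongr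
    _ ≤ rPlus ^ 2 * c₀ := by
      have := S.r_nonneg p hp
      have := r_le_rPlus hS hp
      gcongr

lemma du_rv_neg_of_scaledTuv_le {c₀ : ℝ} (hc₀ : 0 ≤ c₀) (hc : rPlus ^ 2 * c₀ < 1 / 4)
    {p : ℝ × ℝ} (hp : p ∈ S.tube) (hT : S.scaledTuv p ≤ c₀) : du S.G S.rv p < 0 := by
  have hw := wave_u hp.1 hp.2.2.ne
  rw [hp.2.1, mul_zero, add_zero] at hw
  have hΩ := S.Ω_pos p hp.1
  have h1 := sq_mul_le hS hc₀ hp.1 hT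
  have hneg : S.r p * du S.G S.rv p < 0 := by
    rw [hw]; exact mul_neg_of_pos_of_neg (by positivity) (by linarith)
  by_contra! h
  exact absurd (mul_nonneg (S.r_nonneg p hp.1) h) (not_le.2 hneg)

/-- Grönwall's inequality for the Raychaudhuri equation in `u`: the bound `T_uu ≤ c₁ (∂_u r)²`
carries a bound for `-Ω⁻² ∂_u r` from the event horizon into the spacetime. -/
lemma neg_scaledRu_le {c₁ c₂ u v : ℝ} (hc₁ : 0 ≤ c₁) (hp : (u, v) ∈ S.G)
    (hT : ∀ x ∈ Icc 0 u, S.Tuu (x, v) ≤ c₁ * S.ru (x, v) ^ 2)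
    (hC : -S.ru (0, v) * (S.Ω (0, v) ^ 2)⁻¹ ≤ c₂) :
    -S.ru (u, v) ≤ c₂ * Real.exp (rPlus * c₁ * rPlus) * S.Ω (u, v) ^ 2 := by
  have hu := nonneg_of_mem hp
  have hr0 := (rPlus_pos hS).le
  have hmem : ∀ x ∈ Icc 0 u, (x, v) ∈ S.G :=
    fun x hx => mem_of_le hS hp hx.1 hx.2 (le_of_mem hp) le_rfl
  have hder : ∀ x ∈ Icc 0 u, HasDerivWithinAt
      (fun x => Real.exp (rPlus * c₁ * S.r (x, v)) * ((S.Ω (x, v) ^ 2)⁻¹ * S.ru (x, v)))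
      (Real.exp (rPlus * c₁ * S.r (x, v)) * (S.Ω (x, v) ^ 2)⁻¹ *
        (rPlus * c₁ * S.ru (x, v) ^ 2 - S.r (x, v) * S.Tuu (x, v))) (Icc 0 u) x := by
    intro x hx
    have h1 := (hasDerivWithinAt_du S.r_smooth hmem (hmem x hx)).const_mul (rPlus * c₁)
    have h2 := hasDerivWithinAt_du S.scaledRu_smooth hmem (hmem x hx)
    have hR : du S.G (fun p => (S.Ω p ^ 2)⁻¹ * S.ru p) (x, v) = _ :=
      S.raychaudhuri_u _ (hmem x hx)
    rw [hR] at h2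
    refine (h1.exp.mul h2).congr_deriv ?_
    change Real.exp _ * (rPlus * c₁ * S.ru (x, v)) * _ + _ = _
    ring
  have hmono := monotoneOn_of_hasDerivWithinAt_nonneg (convex_Icc 0 u)
    (fun x hx => (hder x hx).continuousWithinAt)
    (fun x hx => (hder x (interior_subset hx)).mono interior_subset)
    (fun x hx => by
      have hx' := interior_subset hx
      have hΩ := S.Ω_pos _ (hmem x hx')
      have h1 : S.r (x, v) * S.Tuu (x, v) ≤ rPlus * (c₁ * S.ru (x, v) ^ 2) :=
        mul_le_mul (r_le_rPlus hS (hmem x hx')) (hT x hx') (hS.energy _ (hmem x hx')).1 hr0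
      exact mul_nonneg (by positivity) (by linarith))
  have h := hmono ⟨le_rfl, hu⟩ ⟨hu, le_rfl⟩ hu
  simp only at h
  have hΩ := S.Ω_pos _ hp
  have h0 : Real.exp (rPlus * c₁ * S.r (0, v)) * (-S.ru (0, v) * (S.Ω (0, v) ^ 2)⁻¹) ≤
      Real.exp (rPlus * c₁ * rPlus) * c₂ := by
    have h1 := r_le_rPlus hS (hmem 0 ⟨le_rfl, hu⟩)
    have h2 := ru_neg hS (hmem 0 ⟨le_rfl, hu⟩)
    have h3 : 0 ≤ -S.ru (0, v) * (S.Ω (0, v) ^ 2)⁻¹ :=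
      mul_nonneg (by linarith) (by positivity)
    gcongr
  have hq : 0 ≤ (S.Ω (u, v) ^ 2)⁻¹ * -S.ru (u, v) :=
    mul_nonneg (by positivity) (by linarith [ru_neg hS hp])
  have h1 : (S.Ω (u, v) ^ 2)⁻¹ * -S.ru (u, v) ≤
      Real.exp (rPlus * c₁ * S.r (u, v)) * ((S.Ω (u, v) ^ 2)⁻¹ * -S.ru (u, v)) := by
    refine le_mul_of_one_le_left hq (Real.one_le_exp ?_)
    have := S.r_nonneg _ hp
    positivity
  have h2 : (S.Ω (u, v) ^ 2)⁻¹ * -S.ru (u, v) ≤ c₂ * Real.exp (rPlus * c₁ * rPlus) := by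
    linarith
  rwa [inv_mul_le_iff₀ (by positivity), mul_comm] at h2

/-- A full strip `[0, u] × [V, ∞)` cannot be regular. In it `g = -r ∂_u r` satisfies
`∂_v g = Ω² (1/4 - r² Ω⁻² T_uv)`, which is bounded below by a positive constant because `Ω²`
dominates `-∂_u r ≥ g / r₊` and `g` is nondecreasing in `v`. So `g` grows at least linearly in `v`,
while `2 ∫ g du ≤ r₊²`. -/
lemma false_of_regular_strip {c₀ c₁ c₂ u V : ℝ} (hc₀ : 0 ≤ c₀) (hc : rPlus ^ 2 * c₀ < 1 / 4)
    (hc₁ : 0 ≤ c₁) (hc₂ : 0 < c₂) (hu : 0 < u)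
    (hreg : ∀ x ∈ Icc 0 u, ∀ v, V ≤ v → (x, v) ∈ S.regular)
    (hr : ∀ x ∈ Icc 0 u, 0 < S.r (x, V))
    (hTuv : ∀ x ∈ Icc 0 u, ∀ v, V ≤ v → S.scaledTuv (x, v) ≤ c₀)
    (hTuu : ∀ x ∈ Icc 0 u, ∀ v, V ≤ v → S.Tuu (x, v) ≤ c₁ * S.ru (x, v) ^ 2)
    (hC : ∀ v, V ≤ v → -S.ru (0, v) * (S.Ω (0, v) ^ 2)⁻¹ ≤ c₂) : False := by
  have hrP := rPlus_pos hS
  have hcont : ContinuousOn (fun x => -(S.r (x, V) * S.ru (x, V))) (Icc 0 u) :=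
    ((S.r_smooth.continuousOn.mul S.ru_smooth.continuousOn).neg).comp
      (f := fun x => (x, V)) (by fun_prop) (fun x hx => (hreg x hx V le_rfl).1)
  obtain ⟨x₀, hx₀, hmin⟩ := isCompact_Icc.exists_isMinOn (nonempty_Icc.2 hu.le) hcont
  set μ := -(S.r (x₀, V) * S.ru (x₀, V))
  have hμ : 0 < μ := by
    have := mul_neg_of_pos_of_neg (hr x₀ hx₀) (hreg x₀ hx₀ V le_rfl).2.2
    simp only [μ]; linarith
  set κ := 1 / 4 - rPlus ^ 2 * c₀ with hκdef
  have hκ : 0 < κ := by simp only [κ]; linarith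
  have hgder : ∀ x ∈ Icc 0 u, ∀ v ∈ Ici V, HasDerivWithinAt
      (fun w => -(S.r (x, w) * S.ru (x, w)))
      (S.Ω (x, v) ^ 2 * (1 / 4 - S.r (x, v) ^ 2 * S.scaledTuv (x, v))) (Ici V) v := by
    intro x hx v hv
    have hm : ∀ w ∈ Ici V, (x, w) ∈ S.G := fun w hw => (hreg x hx w hw).1
    have h := ((hasDerivWithinAt_dv S.r_smooth hm (hm v hv)).mul
      (hasDerivWithinAt_dv S.ru_smooth hm (hm v hv))).neg
    refine h.congr_deriv ?_
    have hw := wave_v (hm v hv) (hreg x hx v hv).2.1.ne'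
    change -(S.rv (x, v) * _ + _) = _
    linear_combination -hw
  have hgder_ge : ∀ x ∈ Icc 0 u, ∀ v ∈ Ici V, S.Ω (x, v) ^ 2 * κ ≤
      S.Ω (x, v) ^ 2 * (1 / 4 - S.r (x, v) ^ 2 * S.scaledTuv (x, v)) := by
    intro x hx v hv
    have := sq_mul_le hS hc₀ (hreg x hx v hv).1 (hTuv x hx v hv)
    gcongr
    linarith
  have hgμ : ∀ x ∈ Icc 0 u, ∀ v ∈ Ici V, μ ≤ -(S.r (x, v) * S.ru (x, v)) := by
    intro x hx v hv
    have hmono := monotoneOn_of_hasDerivWithinAt_nonneg (convex_Ici V)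
      (fun v hv => (hgder x hx v hv).continuousWithinAt)
      (fun v hv => (hgder x hx v (interior_subset hv)).mono interior_subset)
      (fun v hv => le_trans (by positivity) (hgder_ge x hx v (interior_subset hv)))
    exact (hmin hx).trans (hmono self_mem_Ici hv hv)
  set D := c₂ * Real.exp (rPlus * c₁ * rPlus)
  have hD : 0 < D := by positivity
  set k := μ / (rPlus * D) * κ
  have hk : 0 < k := by positivity
  have hΩ : ∀ x ∈ Icc 0 u, ∀ v ∈ Ici V, k ≤ S.Ω (x, v) ^ 2 * κ := by
    intro x hx v hv
    have hG := (hreg x hx v hv).1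
    have h1 := neg_scaledRu_le hS hc₁ hG
      (fun y hy => hTuu y ⟨hy.1, hy.2.trans hx.2⟩ v hv) (hC v hv)
    have h2 : -(S.r (x, v) * S.ru (x, v)) ≤ rPlus * -S.ru (x, v) := by
      have := mul_le_mul_of_nonneg_right (r_le_rPlus hS hG)
        (neg_nonneg.2 (hreg x hx v hv).2.2.le)
      linarith
    have h3 : μ ≤ rPlus * (D * S.Ω (x, v) ^ 2) :=
      (hgμ x hx v hv).trans (h2.trans (mul_le_mul_of_nonneg_left h1 hrP.le))
    have h4 : μ / (rPlus * D) ≤ S.Ω (x, v) ^ 2 := by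
      rw [div_le_iff₀ (by positivity)]; linarith
    exact mul_le_mul_of_nonneg_right h4 hκ.le
  have hlin : ∀ x ∈ Icc 0 u, ∀ v ∈ Ici V, k * (v - V) ≤ -(S.r (x, v) * S.ru (x, v)) := by
    intro x hx v hv
    have hd : ∀ w ∈ Ici V, HasDerivWithinAt
        (fun w => -(S.r (x, w) * S.ru (x, w)) - k * w)
        (S.Ω (x, w) ^ 2 * (1 / 4 - S.r (x, w) ^ 2 * S.scaledTuv (x, w)) - k * 1) (Ici V) w :=
      fun w hw => (hgder x hx w hw).sub ((hasDerivWithinAt_id w _).const_mul k)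
    have hmono := monotoneOn_of_hasDerivWithinAt_nonneg (convex_Ici V)
      (fun v hv => (hd v hv).continuousWithinAt)
      (fun v hv => (hd v (interior_subset hv)).mono interior_subset)
      (fun v hv => by
        linarith [hΩ x hx v (interior_subset hv), hgder_ge x hx v (interior_subset hv)])
    have h1 := hmono self_mem_Ici hv hv
    have h2 := hgμ x hx V self_mem_Ici
    simp only at h1
    linarith
  set v := V + rPlus ^ 2 / (k * u) with hvdef
  have hv : v ∈ Ici V := by
    have : 0 ≤ rPlus ^ 2 / (k * u) := by positivity
    simp only [mem_Ici, hvdef]; linarith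
  have hsq : ∀ x ∈ Icc 0 u, HasDerivWithinAt
      (fun x => S.r (x, v) * S.r (x, v) + 2 * (k * (v - V)) * x)
      (S.ru (x, v) * S.r (x, v) + S.r (x, v) * S.ru (x, v) + 2 * (k * (v - V)) * 1)
      (Icc 0 u) x := by
    intro x hx
    have hm : ∀ y ∈ Icc 0 u, (y, v) ∈ S.G := fun y hy => (hreg y hy v hv).1
    have h := hasDerivWithinAt_du S.r_smooth hm (hm x hx)
    exact (h.mul h).add ((hasDerivWithinAt_id x _).const_mul _)
  have hanti := antitoneOn_of_hasDerivWithinAt_nonpos (convex_Icc 0 u)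
    (fun x hx => (hsq x hx).continuousWithinAt)
    (fun x hx => (hsq x (interior_subset hx)).mono interior_subset)
    (fun x hx => by linarith [hlin x (interior_subset hx) v hv])
  have h := hanti ⟨le_rfl, hu.le⟩ ⟨hu.le, le_rfl⟩ hu.le
  have hkv : k * (v - V) * u = rPlus ^ 2 := by
    simp only [hvdef]; field_simp; ring
  have h0G := (hreg 0 ⟨le_rfl, hu.le⟩ v hv).1
  have h0 : S.r (0, v) * S.r (0, v) ≤ rPlus * rPlus :=
    mul_le_mul (r_le_rPlus hS h0G) (r_le_rPlus hS h0G) (S.r_nonneg _ h0G) hrP.le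
  simp only [mul_zero, add_zero] at h
  nlinarith [mul_self_nonneg (S.r (u, v)), mul_pos hrP hrP]

/-! ### A strip along the event horizon -/

lemma exists_regular_box (V : ℝ) : ∃ η, 0 < η ∧ η ≤ u₀ ∧
    ∀ u ∈ Icc 0 η, ∀ v ∈ Icc v₀ V, (u, v) ∈ S.regular := by
  have h := (isCompact_Icc (a := v₀) (b := V)).eventually_forall_of_forall_eventually (x₀ := (0 : ℝ))
    (P := fun u v => (u, v) ∈ K u₀ v₀ → (u, v) ∈ S.regular) fun v hv =>
      eventually_nhdsWithin_iff.1
        (eventually_regular (Cout_subset_regular hS (Cout_mem hv.1)))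
  obtain ⟨η, hη, hball⟩ := Metric.eventually_nhds_iff.1 h
  refine ⟨min (η / 2) u₀, lt_min (by linarith) S.u₀_pos, min_le_right _ _, fun u hu v hv => ?_⟩
  refine hball ?_ v hv ⟨⟨hu.1, hu.2.trans (min_le_right _ _)⟩, hv.1⟩
  rw [Real.dist_eq, sub_zero, abs_of_nonneg hu.1]
  linarith [hu.2.trans (min_le_left (η / 2) u₀)]

/-- Close to the horizon and beyond a level `v = V` at which `r` nearly attains its supremum, the
regular region and the tube lie in `{r ≥ r₊ - δ}`. -/
lemma exists_strip {δ : ℝ} (hδ : 0 < δ) : ∃ U V, 0 < U ∧ U ≤ u₀ ∧ v₀ ≤ V ∧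
    (∀ u ∈ Icc 0 U, ∀ v ∈ Icc v₀ V, (u, v) ∈ S.regular) ∧
    ∀ u ∈ Icc 0 U, rPlus - δ ≤ S.r (u, V) ∧ 0 < S.r (u, V) := by
  obtain ⟨_, ⟨⟨a, V⟩, ⟨ha, hV⟩, rfl⟩, hlt⟩ :=
    (lt_isLUB_iff hS.r_sup).1 (show rPlus - δ < rPlus by linarith)
  obtain rfl : a = 0 := ha
  obtain ⟨η, hη, hη₀, hbox⟩ := exists_regular_box hS V
  have hm : ∀ x ∈ Icc 0 η, (x, V) ∈ S.G := fun x hx => (hbox x hx V ⟨hV, le_rfl⟩).1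
  have hc : ContinuousWithinAt (fun x => S.r (x, V)) (Icc 0 η) 0 :=
    (hasDerivWithinAt_du S.r_smooth hm (hm 0 ⟨le_rfl, hη.le⟩)).continuousWithinAt
  have hpos : 0 < S.r (0, V) := S.r_pos _ (Or.inr (Cout_mem hV))
  obtain ⟨θ, hθ, hball⟩ := Metric.mem_nhdsWithin_iff.1
    ((hc.eventually (lt_mem_nhds hlt)).and (hc.eventually (lt_mem_nhds hpos)))
  refine ⟨min η (θ / 2), V, lt_min hη (by linarith), (min_le_left _ _).trans hη₀, hV,
    fun u hu v hv => hbox u ⟨hu.1, hu.2.trans (min_le_left _ _)⟩ v hv, fun u hu => ?_⟩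
  have := hball (show u ∈ Metric.ball (0 : ℝ) θ ∩ Icc 0 η from ⟨by
    rw [Metric.mem_ball, Real.dist_eq, sub_zero, abs_of_nonneg hu.1]
    linarith [hu.2.trans (min_le_right η (θ / 2))], hu.1, hu.2.trans (min_le_left _ _)⟩)
  exact ⟨this.1.le, this.2⟩

/-- The bound on `Ω⁻² T_uv` in the regular region extends by continuity to the adjacent points of
the tube; by the wave equation `∂_u ∂_v r < 0` there. -/
lemma isGoodStrip_of_bound {c₀ U U' V : ℝ} (hc₀ : 0 ≤ c₀) (hc : rPlus ^ 2 * c₀ < 1 / 4)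
    (hUU' : U < U') (hU' : U' ≤ u₀) (hV : v₀ ≤ V)
    (hbox : ∀ u ∈ Icc 0 U', ∀ v ∈ Icc v₀ V, (u, v) ∈ S.regular)
    (hT : ∀ p ∈ S.regular, p.1 ≤ U' → V ≤ p.2 → S.scaledTuv p ≤ c₀) : S.IsGoodStrip U where
  le := hUU'.le.trans hU'
  Cin_regular u h0 hu := hbox u ⟨h0, hu.trans hUU'.le⟩ v₀ ⟨le_rfl, hV⟩
  du_rv_neg := by
    rintro ⟨u, v⟩ hp hcl hu
    have hVv : V < v := by
      by_contra! h
      have := hbox u ⟨nonneg_of_mem hp.1, hu.trans hUU'.le⟩ v ⟨le_of_mem hp.1, h⟩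
      exact this.2.1.ne' hp.2.1
    refine du_rv_neg_of_scaledTuv_le hS hc₀ hc hp ?_
    have hcont : ContinuousWithinAt S.scaledTuv S.regular (u, v) :=
      (S.scaledTuv_smooth.continuousOn _ hp.1).mono fun q hq => hq.1
    have := mem_closure_iff_nhdsWithin_neBot.1 hcl
    have hev : ∀ᶠ q in 𝓝[S.regular] (u, v), q.1 < U' ∧ V < q.2 :=
      ((continuous_fst.continuousAt.eventually (gt_mem_nhds (hu.trans_lt hUU'))).and
        (continuous_snd.continuousAt.eventually (lt_mem_nhds hVv))).filter_mono nhdsWithin_le_nhds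
    refine le_of_tendsto hcont ?_
    filter_upwards [hev, self_mem_nhdsWithin] with q hq hqr
    exact hT q hqr hq.1.le hq.2.le

end

end Spacetime
end SphericalSpacetime

open SphericalSpacetime in
theorem theorem4p1 {u₀ v₀ : ℝ} (S : Spacetime u₀ v₀) (rPlus mPlus : ℝ)
    (hS : S.IsBlackHole rPlus mPlus)
    (c₀ c₁ c₂ ε v' δ : ℝ)
    (hc₀ : 0 < c₀) (hc₀' : c₀ < 1 / (4 * rPlus ^ 2)) (hc₁ : 0 < c₁) (hc₂ : 0 < c₂)
    (hε : 0 < ε) (hε' : ε < 1 / (4 * rPlus ^ 2) - c₀) (hv' : v₀ ≤ v') (hδ : 0 < δ)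
    (hA' : ∀ p ∈ S.W rPlus δ ∩ S.regular, S.scaledTuv p ≤ c₀)
    (hB1 : ∀ p ∈ S.W rPlus δ ∩ S.regular, S.Tuu p / (S.ru p) ^ 2 ≤ c₁)
    (hB2 : ∀ u ∈ Set.Icc 0 u₀, MeasureTheory.IntegrableOn
      (fun v : ℝ => dv S.G S.scaledTuv (u, v)) {v : ℝ | (u, v) ∈ S.G})
    (hB2' : ∀ u v : ℝ, (u, v) ∈ S.W rPlus δ ∩ S.regular → v' ≤ v →
      ∫ w in v'..v, dv S.G S.scaledTuv (u, w) < ε)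
    (hC : ∀ p ∈ Cout v₀ ∩ S.W rPlus δ, -S.ru p * (S.Ω p ^ 2)⁻¹ ≤ c₂) :
    ∃ U : ℝ, 0 < U ∧ U ≤ u₀ ∧
      (∀ u : ℝ, 0 < u → u ≤ U → ∃ v : ℝ, v₀ < v ∧ (u, v) ∈ S.tube) ∧
      ∃ V : ℝ, v₀ ≤ V ∧ ∀ V₁ : ℝ, V ≤ V₁ →
        IsConnected (S.tube ∩ K U V₁) ∧ Achronal (S.tube ∩ K U V₁) ∧
          NoIngoingNullSegments (S.tube ∩ K U V₁) := by
  open Spacetime in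
  have hrP := rPlus_pos hS
  have hc : rPlus ^ 2 * c₀ < 1 / 4 := by
    rw [lt_div_iff₀ (by positivity)] at hc₀'
    linarith
  obtain ⟨U', V, hU'0, hU'u, hV, hbox, hr⟩ := exists_strip hS hδ
  have hW : ∀ p ∈ S.regular, p.1 ≤ U' → V ≤ p.2 → p ∈ S.W rPlus δ ∩ S.regular := by
    rintro ⟨u, v⟩ hp hu hv
    refine ⟨⟨hp.1, ?_⟩, hp⟩
    exact (hr u ⟨nonneg_of_mem hp.1, hu⟩).1.trans
      (r_monotone hS hp.1 hp.2.1.le ⟨hV, hv⟩ ⟨hV.trans hv, le_rfl⟩ hv)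
  have hT := fun p hp hu hv => hA' p (hW p hp hu hv)
  -- Halving leaves room on the right edge, where points of the tube could be limits of regular
  -- points with larger `u`.
  have hU := isGoodStrip_of_bound hS hc₀.le hc (half_lt_self hU'0) hU'u hV hbox hT
  have hle : U' / 2 ≤ U' := (half_lt_self hU'0).le
  have hex : ∀ u : ℝ, 0 < u → u ≤ U' / 2 → ∃ v : ℝ, v₀ < v ∧ (u, v) ∈ S.tube := by
    intro u hu0 hu
    by_contra! hno
    have hCin := hU.Cin_regular u hu0.le hu
    have hray : ∀ v, v₀ ≤ v → (u, v) ∈ S.regular := by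
      intro v hv
      by_contra hnot
      obtain ⟨s, hs, hst⟩ := exists_tube_of_path hS hU (γ := fun s => (u, s)) (by fun_prop) hv
        (fun s hs => ⟨⟨hu0.le, hu⟩, hs.1⟩) hCin hnot
      rcases hs.1.lt_or_eq with h | h
      · exact hno s h hst
      · have e : ((u, s) : ℝ × ℝ) = (u, v₀) := Prod.ext rfl h.symm
        simp only [e] at hst
        exact hCin.2.1.ne' hst.2.1
    have hreg : ∀ x ∈ Set.Icc 0 u, ∀ v, V ≤ v → (x, v) ∈ S.regular := fun x hx v hv =>
      regular_of_le hS hU (hray v (hV.trans hv)) hu hx.1 hx.2 (hV.trans hv) le_rfl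
    have hx' : ∀ x ∈ Set.Icc 0 u, x ≤ U' := fun x hx => hx.2.trans (hu.trans hle)
    refine false_of_regular_strip hS hc₀.le hc hc₁.le hc₂ hu0 hreg
      (fun x hx => (hr x ⟨hx.1, hx' x hx⟩).2)
      (fun x hx v hv => hT _ (hreg x hx v hv) (hx' x hx) hv)
      (fun x hx v hv => ?_) (fun v hv => ?_)
    · have h := hB1 _ (hW _ (hreg x hx v hv) (hx' x hx) hv)
      rwa [div_le_iff₀ (sq_pos_of_neg (hreg x hx v hv).2.2)] at h
    · exact hC _ ⟨Cout_mem (hV.trans hv),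
        (hW _ (hreg 0 ⟨le_rfl, hu0.le⟩ v hv) (hx' 0 ⟨le_rfl, hu0.le⟩) hv).1⟩
  refine ⟨U' / 2, half_pos hU'0, hle.trans hU'u, hex, V, hV, fun V₁ hV₁ =>
    ⟨⟨?_, tube_isPreconnected hS hU V₁⟩, ?_, ?_⟩⟩
  · -- Near the horizon the tube lies above any given level.
    obtain ⟨η, hη, -, hbox₁⟩ := exists_regular_box hS V₁
    obtain ⟨v, hv, hvt⟩ := hex (min η (U' / 2)) (lt_min hη (half_pos hU'0)) (min_le_right _ _)
    refine ⟨_, hvt, ⟨nonneg_of_mem hvt.1, min_le_right _ _⟩, ?_⟩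
    change V₁ ≤ v
    by_contra! h
    have := hbox₁ _ ⟨nonneg_of_mem hvt.1, min_le_left _ _⟩ v ⟨hv.le, h.le⟩
    exact this.2.1.ne' hvt.2.1
  · exact fun p hp q hq => tube_achronal hS hU p ⟨hp.1, hp.2.1.2⟩ q ⟨hq.1, hq.2.1.2⟩
  · intro a b v hab hsub
    have ha := hsub (show (a, v) ∈ Set.Icc a b ×ˢ {v} from ⟨⟨le_rfl, hab.le⟩, rfl⟩)
    have hb := hsub (show (b, v) ∈ Set.Icc a b ×ˢ {v} from ⟨⟨hab.le, le_rfl⟩, rfl⟩)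
    exact tube_eq_of_snd_eq hS hU ha.1 hb.1 hb.2.1.2 hab
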